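/- Let $n,k,d$ be integers with $n\ge 2$, $1\le k\le n-1$, $1\le d\le n-1$, and let $\mathcal M>0$ be the file size. **Family scheme.** On a group of $N>d$ nodes $1,\dots,N$, consecutive nodes are grouped into $\lfloor N/(N-d)\rfloor$ complete families of $N-d$ nodes; the remaining $N \bmod (N-d)$ nodes form an incomplete family. The helper set of a node of a complete family consists of all nodes of the group outside its family (there are $d$ of them); the helper set of a node of the incomplete family is $\{1,\dots,d\}$. **Family-plus scheme.** The $n$ nodes are partitioned into regular groups of $2d$ nodes and, if $n\bmod(2d)\neq 0$, one remaining group whose size $n_{\text{remain}}$ is as small as possible subject to $n_{\text{remain}}\ge 2d+1$ (if $n<2d$ there is only one group, consisting of all $n$ nodes). The family scheme is applied to each group separately. This gives a helper set $D_i$ of $d$ nodes for each node $i$. **Information flow graphs.** For a finite sequence of node failures, the information flow graph has a source $s$ and, for each of the $n$ initial nodes and for each newcomer, a pair $x_{\rm in},x_{\rm out}$ joined by an edge $x_{\rm in}\to x_{\rm out}$ of capacity $\alpha$. There are edges of infinite capacity from $s$ to $x_{\rm in}$ of each initial node. When node $i$ fails, it becomes inactive and is replaced by a newcomer whose $x_{\rm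 in}$ receives an edge of capacity $\beta$ from $x_{\rm out}$ of the currently active copy of each node of $D_i$. For every choice of $k$ of the $n$ finally active nodes there is a data collector $t$ that receives edges of infinite capacity from their outputs. Let $C(\alpha,\beta)$ be the minimum, over all failure sequences and all data collectors $t$, of the min-cut value between $s$ and $t$. **MBR point.** Put $\beta_{\text{MBR}}=\min\{\beta\ge 0: C(\infty,\beta)\ge\mathcal M\}$, $\alpha_{\text{MBR}}=\min\{\alpha\ge 0: C(\alpha,\beta_{\text{MBR}})\ge\mathcal M\}$, and $\gamma_{\text{MBR}}=d\beta_{\text{MBR}}$ (the repair bandwidth). **Statement.** For the family-plus scheme these minima exist, and $$\alpha_{\text{MBR}}=\gamma_{\text{MBR}}=d\,\beta_{\text{MBR}}.$$ If moreover $n\ge 2d$, then $\beta_{\text{MBR}}$ satisfies $$\Bigg(1_{\{n\bmod(2d)\neq 0\}}\sum_{i=0}^{\min(k,2d-1)-1}\Big(d-i+\Big\lfloor\frac i2\Big\rfloor\Big)+d^2\Big\lfloor\frac{(k-n_l)^+}{2d}\Big\rfloor+\sum_{i=0}^{q}\Big(d-i+\Big\lfloor\frac i2\Big\rfloor\Big)\Bigg)\beta_{\text{MBR}}=\mathcal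 M,$$ where $(x)^+=\max(x,0)$, $q=\big((k-n_l)^+\bmod(2d)\big)-1$ (a sum with upper limit $-1$ is empty), $n_l=n_{\text{remain}}$ if $n\bmod(2d)\neq0$, and $n_l=0$ otherwise. -/

import Mathlib

open scoped NNReal ENNReal

noncomputable section

namespace HelperSelection

/-! ### Minimum cuts -/

open Classical in
/-- The minimum cut value separating `s` from `t` in the finite directed network with edge
capacities `cap` (capacity `0` means that there is no edge): the least total capacity of the edges
leaving `U`, over all vertex sets `U` that contain `s` and do not contain `t`. -/
def minCut {V : Type} [Fintype V] (cap : V → V → ℝ≥0∞) (s t : V) : ℝ≥0∞ :=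
  ⨅ U : {U : Finset V // s ∈ U ∧ t ∉ U}, ∑ u ∈ U.1, ∑ v ∈ U.1ᶜ, cap u v

/-! ### Information flow graphs of a stationary helper selection scheme

The physical nodes are the elements of `Fin n`. A stationary scheme is a family of helper sets
`D : Fin n → Finset (Fin n)`. A failure history of length `T` is a function `F : Fin T → Fin n`:
at time `τ` the physical node `F τ` fails and is replaced by a newcomer. -/

/-- The storage nodes of an information flow graph: `Sum.inl i` is the initial node `i`, and
`Sum.inr τ` is the newcomer that is created at time `τ`. -/
abbrev StorageNode (n T : ℕ) : Type := Fin n ⊕ Fin T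

/-- The physical node that a storage node represents. -/
def StorageNode.physical {n T : ℕ} (F : Fin T → Fin n) : StorageNode n T → Fin n
  | Sum.inl i => i
  | Sum.inr τ => F τ

/-- The storage node exists and is active just before time `τ`: it has been created before time
`τ`, and its physical node has not failed from then on until time `τ` (exclusive). -/
def StorageNode.IsActive {n T : ℕ} (F : Fin T → Fin n) (τ : ℕ) : StorageNode n T → Prop
  | Sum.inl i => ∀ ρ : Fin T, (ρ : ℕ) < τ → F ρ ≠ i
  | Sum.inr σ => (σ : ℕ) < τ ∧ ∀ ρ : Fin T, σ < ρ → (ρ : ℕ) < τ → F ρ ≠ F σ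

/-- The data collectors of the information flow graph with failure history `F`: one for each way
of choosing `k` of the storage nodes that are active after all the failures of `F`. -/
abbrev DataCollector {n T : ℕ} (F : Fin T → Fin n) (k : ℕ) : Type :=
  {S : Finset (StorageNode n T) // S.card = k ∧ ∀ x ∈ S, StorageNode.IsActive F T x}

/-- The vertices of an information flow graph. -/
inductive IFGVertex {n T : ℕ} (F : Fin T → Fin n) (k : ℕ) : Type
  | source : IFGVertex F k
  | inp (x : StorageNode n T) : IFGVertex F k
  | out (x : StorageNode n T) : IFGVertex F k
  | collector (t : DataCollector F k) : IFGVertex F k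

/-- An information flow graph has finitely many vertices. -/
instance {n T : ℕ} (F : Fin T → Fin n) (k : ℕ) : Fintype (IFGVertex F k) := by
  classical
  exact Fintype.ofSurjective
    (fun z : (Unit ⊕ StorageNode n T) ⊕ (StorageNode n T ⊕ DataCollector F k) =>
      match z with
      | Sum.inl (Sum.inl _) => IFGVertex.source
      | Sum.inl (Sum.inr x) => IFGVertex.inp x
      | Sum.inr (Sum.inl x) => IFGVertex.out x
      | Sum.inr (Sum.inr t) => IFGVertex.collector t)
    (by
      rintro (_ | x | x | t)
      · exact ⟨Sum.inl (Sum.inl ()), rfl⟩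
      · exact ⟨Sum.inl (Sum.inr x), rfl⟩
      · exact ⟨Sum.inr (Sum.inl x), rfl⟩
      · exact ⟨Sum.inr (Sum.inr t), rfl⟩)

open Classical in
/-- The edge capacities of the information flow graph that is generated by the helper sets `D` and
the failure history `F`:
* the source is joined to the input of every initial storage node by an edge of infinite capacity;
* the input of every storage node is joined to its output by an edge of capacity `α`;
* the newcomer of time `τ` receives an edge of capacity `β` from the output of every storage node
  that is active at that time and represents one of the helpers in `D (F τ)`;
* a data collector receives an edge of infinite capacity from the output of each of its `k` active
  storage nodes;
* there are no other edges. -/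
def ifgCapacity {n T : ℕ} (D : Fin n → Finset (Fin n)) (F : Fin T → Fin n) (k : ℕ)
    (α β : ℝ≥0∞) : IFGVertex F k → IFGVertex F k → ℝ≥0∞
  | .source, .inp (Sum.inl _) => ⊤
  | .inp x, .out y => if x = y then α else 0
  | .out x, .inp (Sum.inr τ) =>
      if StorageNode.IsActive F τ x ∧ StorageNode.physical F x ∈ D (F τ) then β else 0
  | .out x, .collector t => if x ∈ t.1 then ⊤ else 0
  | _, _ => 0

/-- The minimum of the min-cut values between the source and a data collector, over all the
information flow graphs that the scheme `D` generates and all their data collectors. -/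
def schemeMinCut {n : ℕ} (D : Fin n → Finset (Fin n)) (k : ℕ) (α β : ℝ≥0∞) : ℝ≥0∞ :=
  ⨅ (T : ℕ) (F : Fin T → Fin n) (t : DataCollector F k),
    minCut (ifgCapacity D F k α β) .source (.collector t)

/-- The min-cut condition for storing a file of size `M` with per-node storage `α` (possibly
infinite) and per-helper repair traffic `β`. -/
def Satisfies {n : ℕ} (D : Fin n → Finset (Fin n)) (k : ℕ) (M : ℝ≥0) (α β : ℝ≥0∞) : Prop :=
  (M : ℝ≥0∞) ≤ schemeMinCut D k α β

/-- `(α, β)` is the minimum-bandwidth-regenerating point of the scheme `D`: `β` is the least value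
that satisfies the min-cut condition with infinite storage, and `α` is the least storage that
satisfies it together with this `β`. -/
structure IsMBRPoint {n : ℕ} (D : Fin n → Finset (Fin n)) (k : ℕ) (M : ℝ≥0) (α β : ℝ≥0) :
    Prop where
  isLeast_beta : IsLeast {b : ℝ≥0 | Satisfies D k M ⊤ (b : ℝ≥0∞)} β
  isLeast_alpha : IsLeast {a : ℝ≥0 | Satisfies D k M (a : ℝ≥0∞) (β : ℝ≥0∞)} α

/-- The total repair bandwidth `γ`: traffic `β` from each of the `d` helpers. -/
def repairBandwidth (d : ℕ) (β : ℝ≥0) : ℝ≥0 := d * β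

/-! ### The family and the family-plus helper selection schemes -/

/-- The helper set of node `i` in the family helper selection scheme on the nodes
`0, …, N - 1` with `d` helpers per node. Consecutive nodes are grouped into families of `N - d`
nodes, so that node `i` lies in the family with index `i / (N - d)`, and the first `N / (N - d)`
families are complete. A node of a complete family is helped by all the nodes outside its family;
a node of the incomplete family is helped by the first `d` nodes. -/
def familyHelpers (N d i : ℕ) : Finset ℕ :=
  if i / (N - d) < N / (N - d) then
    (Finset.range N).filter (fun j => j / (N - d) ≠ i / (N - d))
  else Finset.range d

/-- The number of regular groups (groups of `2 * d` nodes) in the family-plus scheme. If `2 * d`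
divides `n` then all the nodes are in regular groups. Otherwise there are as many regular groups as
possible subject to leaving at least `2 * d + 1` nodes for the remaining group
(and none if `n < 2 * d`, where there is only one group). -/
def numRegular (n d : ℕ) : ℕ :=
  if n % (2 * d) = 0 then n / (2 * d) else n / (2 * d) - 1

/-- The size of the remaining group in the family-plus scheme (`0` if there is none). -/
def remainingSize (n d : ℕ) : ℕ := n - 2 * d * numRegular n d

/-- The first node of the group of node `i`. The regular groups come first, in consecutive order,
followed by the remaining group. -/
def groupStart (n d i : ℕ) : ℕ := 2 * d * min (i / (2 * d)) (numRegular n d)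

/-- The size of the group of node `i`. -/
def groupSize (n d i : ℕ) : ℕ :=
  if i / (2 * d) < numRegular n d then 2 * d else remainingSize n d

/-- The helper sets of the family-plus scheme: the family scheme is applied to each group
separately. -/
def familyPlus (n d : ℕ) (i : Fin n) : Finset (Fin n) :=
  Finset.univ.filter (fun j : Fin n =>
    groupStart n d i ≤ j ∧
      (j - groupStart n d i : ℕ) ∈ familyHelpers (groupSize n d i) d (i - groupStart n d i))

end HelperSelection

end

namespace HelperSelection

/-! ### Active storage nodes. -/

open Finset

/-! The information flow graphs reduce to a problem about lists of distinct nodes. Let `k` distinct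
nodes be repaired in turn, and charge each repair `min α (f * β)`, where `f` counts its helpers that
were not repaired earlier in the list. The least total charge is exactly the least min-cut
(`le_schemeMinCut_iff`): a cut yields such a list by running through the newcomers on the
collector's side in order of time, and a list is realized by failing its nodes in that order.

Let `m` be the least total number of fresh helpers. With `α = ⊤` the least cut is `m * β`, so `β = M
/ m`. Storage `d * β` never binds, since no repair has more than `d` helpers. Smaller storage
strictly lowers the cost of an optimal list, because its first repair has all `d` helpers fresh.
Hence `α = d * β` (`isMBRPoint_of_isLeast`).

It remains to compute `m` when `2 * d ≤ n`. Every group then has two sides, the last `d` nodes and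
the others, and helpers always lie on the opposite side of the same group. If `b` and `c` nodes of
the sides are repaired, at most `b * c` of the `d * (b + c)` helpers are not fresh. Since `b ≤ d`,
balanced sides are best, which gives `groupFresh`. The marginal cost of one more repair in a group
decreases, so it pays to exhaust groups one by one, the remaining group first because its repairs
beyond `2 * d - 1` are free. This proves `planFresh_le_freshHelpers`; letting the two sides take
turns attains the bound (`exists_freshHelpers_le_planFresh`). -/

lemma StorageNode.IsActive.physical_injective {n T : ℕ} {F : Fin T → Fin n} {τ : ℕ}
    {x y : StorageNode n T} (hx : StorageNode.IsActive F τ x) (hy : StorageNode.IsActive F τ y)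
    (h : StorageNode.physical F x = StorageNode.physical F y) : x = y := by
  rcases x with i | σ <;> rcases y with j | ρ
  · simpa [StorageNode.physical] using h
  · exact absurd h.symm (hx ρ hy.1)
  · exact absurd h (hy σ hx.1)
  · rcases lt_trichotomy σ ρ with hlt | heq | hlt
    · exact absurd h.symm (hx.2 ρ hlt hy.1)
    · rw [heq]
    · exact absurd h (hy.2 σ hlt hx.1)

lemma StorageNode.exists_isActive {n T : ℕ} (F : Fin T → Fin n) (p : Fin n) (τ : ℕ) :
    ∃ x : StorageNode n T, StorageNode.IsActive F τ x ∧ StorageNode.physical F x = p := by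
  classical
  by_cases h : (univ.filter (fun ρ : Fin T => (ρ : ℕ) < τ ∧ F ρ = p)).Nonempty
  · obtain ⟨σ, hσ, hmax⟩ := exists_max_image _ id h
    simp only [mem_filter, mem_univ, true_and, id] at hσ hmax
    refine ⟨Sum.inr σ, ⟨hσ.1, fun ρ hρ hρτ he => ?_⟩, hσ.2⟩
    exact absurd (hmax ρ ⟨hρτ, he.trans hσ.2⟩) (not_le.2 hρ)
  · refine ⟨Sum.inl p, fun ρ hρ he => h ⟨ρ, ?_⟩, rfl⟩
    simp [hρ, he]

/-! ### Cuts of an information flow graph. -/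

open Classical in
lemma IFGVertex.sum_eq {n T : ℕ} {F : Fin T → Fin n} {k : ℕ} (f : IFGVertex F k → ℝ≥0∞) :
    ∑ v, f v = f .source + ∑ x, f (.inp x) + (∑ x, f (.out x) + ∑ t, f (.collector t)) := by
  let e : ((Unit ⊕ StorageNode n T) ⊕ (StorageNode n T ⊕ DataCollector F k)) ≃ IFGVertex F k :=
    { toFun := fun z => match z with
        | Sum.inl (Sum.inl _) => .source
        | Sum.inl (Sum.inr x) => .inp x
        | Sum.inr (Sum.inl x) => .out x
        | Sum.inr (Sum.inr t) => .collector t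
      invFun := fun v => match v with
        | .source => Sum.inl (Sum.inl ())
        | .inp x => Sum.inl (Sum.inr x)
        | .out x => Sum.inr (Sum.inl x)
        | .collector t => Sum.inr (Sum.inr t)
      left_inv := by rintro ((_ | x) | (x | t)) <;> rfl
      right_inv := by rintro (_ | x | x | t) <;> rfl }
  rw [← e.sum_comp]
  rw [Fintype.sum_sum_type, Fintype.sum_sum_type (fun z => f (e (Sum.inl z))),
    Fintype.sum_sum_type (fun z => f (e (Sum.inr z)))]
  simp [e]

open Classical in
/-- The value of a cut of an information flow graph, sorted by the heads of the cut edges. -/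
lemma cut_eq {n T : ℕ} (D : Fin n → Finset (Fin n)) (F : Fin T → Fin n) (k : ℕ) (α β : ℝ≥0∞)
    (U : Finset (IFGVertex F k)) (hs : IFGVertex.source ∈ U) :
    ∑ u ∈ U, ∑ v ∈ Uᶜ, ifgCapacity D F k α β u v =
      (∑ i : Fin n, (if .inp (Sum.inl i) ∉ U then (⊤ : ℝ≥0∞) else 0)
        + ∑ τ : Fin T, (if .inp (Sum.inr τ) ∉ U then
            ∑ x : StorageNode n T, (if .out x ∈ U ∧ StorageNode.IsActive F τ x ∧
              StorageNode.physical F x ∈ D (F τ) then β else 0) else 0))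
      + (∑ x : StorageNode n T, (if .out x ∉ U ∧ .inp x ∈ U then α else 0)
        + ∑ t : DataCollector F k, (if .collector t ∉ U then
            ∑ x : StorageNode n T, (if .out x ∈ U ∧ x ∈ t.1 then (⊤ : ℝ≥0∞) else 0) else 0)) := by
  have key : ∀ v, ∑ u ∈ U, ifgCapacity D F k α β u v =
      (ifgCapacity D F k α β .source v
        + ∑ x, if .inp x ∈ U then ifgCapacity D F k α β (.inp x) v else 0)
      + (∑ x, (if .out x ∈ U then ifgCapacity D F k α β (.out x) v else 0)
        + ∑ t, if .collector t ∈ U then ifgCapacity D F k α β (.collector t) v else 0) := by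
    intro v
    have := IFGVertex.sum_eq (fun u => if u ∈ U then ifgCapacity D F k α β u v else 0)
    simp only [hs, if_true] at this
    rw [← this]
    simp
  rw [Finset.sum_comm]
  have h2 : ∀ f : IFGVertex F k → ℝ≥0∞, ∑ v ∈ Uᶜ, f v = ∑ v, if v ∉ U then f v else 0 := by
    intro f
    rw [← Finset.sum_filter]
    congr 1
    ext v; simp
  rw [h2, IFGVertex.sum_eq]
  simp only [key, hs, not_true_eq_false, if_false, zero_add, Fintype.sum_sum_type]
  have h3 : ∀ {ι : Type} [Fintype ι] (P : ι → Prop) (y : ι) (_ : ∀ x, Decidable (x = y))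
      (_ : ∀ x, Decidable (P x)),
      ∑ x, (if P x then (if x = y then α else 0) else 0) = if P y then α else 0 := by
    intro ι _ P y _ _
    rw [Fintype.sum_eq_single y (fun x hx => by simp [hx])]
    simp
  simp [ifgCapacity, ite_and, h3]

/-! ### From cuts to sequences of repairs. -/

variable {n : ℕ}

/-- The cut value of a sequence of repairs. The head of the list is the node that is repaired last,
and a node that is repaired gets new information from those helpers only that are not repaired
before it. -/
noncomputable def repairCost (D : Fin n → Finset (Fin n)) (α β : ℝ≥0∞) : List (Fin n) → ℝ≥0∞
  | [] => 0
  | x :: l => min α ((D x \ l.toFinset).card * β) + repairCost D α β l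

/-- The number of helpers, over all the repairs of a sequence, that are not repaired before. -/
def freshHelpers (D : Fin n → Finset (Fin n)) : List (Fin n) → ℕ
  | [] => 0
  | x :: l => (D x \ l.toFinset).card + freshHelpers D l

lemma repairCost_drop_le (D : Fin n → Finset (Fin n)) (α β : ℝ≥0∞) (l : List (Fin n)) (j : ℕ) :
    repairCost D α β (l.drop j) ≤ repairCost D α β l := by
  induction l generalizing j with
  | nil => simp
  | cons x l ih =>
    cases j with
    | zero => simp
    | succ j => exact (ih j).trans (by rw [repairCost]; exact le_add_self)

lemma repairCost_le_length_mul (D : Fin n → Finset (Fin n)) (α β : ℝ≥0∞) (l : List (Fin n)) :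
    repairCost D α β l ≤ l.length * α := by
  induction l with
  | nil => simp [repairCost]
  | cons x l ih =>
    rw [repairCost, List.length_cons, Nat.cast_succ, add_mul, one_mul, add_comm]
    gcongr
    exact min_le_left _ _

open Classical in
/-- The traffic that the newcomer of time `σ` receives from storage nodes outside `W`. -/
noncomputable def inflow {T : ℕ} (D : Fin n → Finset (Fin n)) (F : Fin T → Fin n) (β : ℝ≥0∞)
    (W : Finset (StorageNode n T)) (σ : Fin T) : ℝ≥0∞ :=
  ∑ x : StorageNode n T, if x ∉ W ∧ StorageNode.IsActive F σ x ∧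
    StorageNode.physical F x ∈ D (F σ) then β else 0

/-- Every physical node has an active copy at time `σ`; for a helper outside `P` this copy cannot
lie in `W`, so its edge counts towards the inflow. -/
lemma card_sdiff_mul_le_inflow {T : ℕ} (D : Fin n → Finset (Fin n)) (F : Fin T → Fin n)
    (β : ℝ≥0∞) (W : Finset (StorageNode n T)) (σ : Fin T) (P : Finset (Fin n))
    (hP : ∀ x ∈ W, StorageNode.IsActive F σ x → StorageNode.physical F x ∈ P) :
    (D (F σ) \ P).card * β ≤ inflow D F β W σ := by
  classical
  rw [inflow, ← Finset.sum_filter, sum_const, nsmul_eq_mul]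
  gcongr
  refine (card_le_card fun p hp => ?_).trans
    (card_image_le (f := StorageNode.physical F))
  obtain ⟨x, hx, rfl⟩ := StorageNode.exists_isActive F p σ
  rw [mem_sdiff] at hp
  refine mem_image_of_mem _ ?_
  simp only [mem_filter, mem_univ, true_and]
  exact ⟨fun h => hp.2 (hP x h hx), hx, hp.1⟩

open Classical in
-- Here `W` is the set of storage nodes whose outputs are on the collector's side. The list starts
-- with the initial nodes in `W`, each paid for by `α`. Then time runs forward: a newcomer in `W` is
-- prepended unless its physical node is already listed, in which case its term is simply wasted.
-- The invariant that the list covers all of `W` created so far makes unlisted helpers active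
-- outside `W`.
lemma exists_repairCost_le {T : ℕ} (D : Fin n → Finset (Fin n)) (F : Fin T → Fin n)
    (α β : ℝ≥0∞) (W : Finset (StorageNode n T)) (τ : ℕ) (hτ : τ ≤ T) :
    ∃ l : List (Fin n), l.Nodup ∧
      (∀ i, Sum.inl i ∈ W → i ∈ l) ∧ (∀ σ : Fin T, (σ : ℕ) < τ → Sum.inr σ ∈ W → F σ ∈ l) ∧
      repairCost D α β l ≤ ∑ i : Fin n, (if Sum.inl i ∈ W then α else 0)
        + ∑ σ : Fin T, (if (σ : ℕ) < τ then
            (if Sum.inr σ ∈ W then min α (inflow D F β W σ) else 0) else 0) := by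
  induction τ with
  | zero =>
    refine ⟨(univ.filter fun i : Fin n => Sum.inl i ∈ W).toList, nodup_toList _, ?_, ?_, ?_⟩
    · simp
    · simp
    · refine (repairCost_le_length_mul _ _ _ _).trans ?_
      rw [← Finset.sum_filter, sum_const, length_toList, nsmul_eq_mul]
      exact le_self_add
  | succ τ ih =>
    obtain ⟨l, hl, h1, h2, h3⟩ := ih (by omega)
    have hsplit : ∀ f : Fin T → ℝ≥0∞, ∑ σ : Fin T, (if (σ : ℕ) < τ + 1 then f σ else 0) =
        f ⟨τ, hτ⟩ + ∑ σ : Fin T, (if (σ : ℕ) < τ then f σ else 0) := by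
      intro f
      have : ∀ σ : Fin T, (if (σ : ℕ) < τ + 1 then f σ else 0) =
          (if σ = ⟨τ, hτ⟩ then f σ else 0) + (if (σ : ℕ) < τ then f σ else 0) := by
        intro σ
        rcases lt_trichotomy (σ : ℕ) τ with h | h | h
        · have : σ ≠ ⟨τ, hτ⟩ := fun e => by simp [e] at h
          simp [h, this, h.trans (Nat.lt_succ_self τ)]
        · have : σ = ⟨τ, hτ⟩ := Fin.ext h
          simp [this]
        · have h' : σ ≠ ⟨τ, hτ⟩ := fun e => by simp [e] at h
          simp [h', not_lt.2 h.le, show ¬ (σ : ℕ) < τ + 1 by omega]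
      simp only [this, sum_add_distrib]
      simp
    rw [hsplit]
    have hlast : ∀ σ : Fin T, (σ : ℕ) < τ + 1 → ¬ (σ : ℕ) < τ → σ = ⟨τ, hτ⟩ := by
      intro σ h h'
      ext
      simp only
      omega
    by_cases hW : Sum.inr ⟨τ, hτ⟩ ∈ W
    · by_cases hm : F ⟨τ, hτ⟩ ∈ l
      · refine ⟨l, hl, h1, fun σ hσ hσW => ?_, h3.trans (by gcongr; exact le_add_self)⟩
        by_cases h : (σ : ℕ) < τ
        · exact h2 σ h hσW
        · rw [hlast σ hσ h]; exact hm
      · refine ⟨F ⟨τ, hτ⟩ :: l, List.nodup_cons.2 ⟨hm, hl⟩,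
          fun i hi => List.mem_cons_of_mem _ (h1 i hi), fun σ hσ hσW => ?_, ?_⟩
        · by_cases h : (σ : ℕ) < τ
          · exact List.mem_cons_of_mem _ (h2 σ h hσW)
          · rw [hlast σ hσ h]; exact List.mem_cons_self
        · rw [repairCost, if_pos hW, add_left_comm]
          gcongr
          refine card_sdiff_mul_le_inflow D F β W ⟨τ, hτ⟩ l.toFinset fun x hx ha => ?_
          rw [List.mem_toFinset]
          rcases x with i | σ
          · exact h1 i hx
          · exact h2 σ ha.1 hx
    · refine ⟨l, hl, h1, fun σ hσ hσW => ?_, h3.trans (by gcongr; exact le_add_self)⟩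
      by_cases h : (σ : ℕ) < τ
      · exact h2 σ h hσW
      · rw [hlast σ hσ h] at hσW; exact absurd hσW hW

/-- Every cut is at least as large as the cut of some sequence of repairs of `k` nodes. -/
lemma exists_repairCost_le_cut {T : ℕ} (D : Fin n → Finset (Fin n)) (F : Fin T → Fin n) (k : ℕ)
    (α β : ℝ≥0∞) (t : DataCollector F k) (l₀ : List (Fin n)) (hl₀ : l₀.Nodup)
    (hk₀ : l₀.length = k) :
    ∃ l : List (Fin n), l.Nodup ∧ l.length = k ∧
      repairCost D α β l ≤ minCut (ifgCapacity D F k α β) .source (.collector t) := by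
  classical
  have hmin : ∃ U : {U : Finset (IFGVertex F k) // .source ∈ U ∧ .collector t ∉ U},
      minCut (ifgCapacity D F k α β) .source (.collector t) =
        ∑ u ∈ U.1, ∑ v ∈ U.1ᶜ, ifgCapacity D F k α β u v := by
    have : Nonempty {U : Finset (IFGVertex F k) // .source ∈ U ∧ .collector t ∉ U} :=
      ⟨⟨{.source}, by simp⟩⟩
    obtain ⟨U, hU⟩ := exists_eq_ciInf_of_finite
      (f := fun U : {U : Finset (IFGVertex F k) // .source ∈ U ∧ .collector t ∉ U} =>
        ∑ u ∈ U.1, ∑ v ∈ U.1ᶜ, ifgCapacity D F k α β u v)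
    refine ⟨U, ?_⟩
    rw [minCut, hU]
  obtain ⟨⟨U, hs, ht⟩, hU⟩ := hmin
  rw [hU, cut_eq D F k α β U hs]
  by_cases hS : ∃ x ∈ t.1, IFGVertex.out x ∈ U
  · obtain ⟨x, hxt, hxU⟩ := hS
    -- The cut contains an infinite edge into the collector, so any list of length `k` will do.
    refine ⟨l₀, hl₀, hk₀, le_top.trans ?_⟩
    refine le_trans ?_ (le_add_self.trans le_add_self)
    refine le_trans ?_ (single_le_sum (fun _ _ => zero_le) (mem_univ t))
    rw [if_pos ht]
    refine le_trans ?_ (single_le_sum (fun _ _ => zero_le) (mem_univ x))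
    rw [if_pos ⟨hxU, hxt⟩]
  push Not at hS
  set W : Finset (StorageNode n T) := univ.filter (fun x => IFGVertex.out x ∉ U) with hWdef
  obtain ⟨l, hl, h1, h2, h3⟩ := exists_repairCost_le D F α β W T le_rfl
  have hkl : k ≤ l.length := by
    rw [← List.toFinset_card_of_nodup hl, ← t.2.1,
      ← card_image_of_injOn (f := StorageNode.physical F) (s := t.1)
        (fun x hx y hy h => (t.2.2 x hx).physical_injective (t.2.2 y hy) h)]
    refine card_le_card fun p hp => ?_
    obtain ⟨x, hx, rfl⟩ := mem_image.1 hp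
    have hxW : x ∈ W := by simpa [hWdef] using hS x hx
    rw [List.mem_toFinset]
    rcases x with i | σ
    · exact h1 i hxW
    · exact h2 σ σ.2 hxW
  -- The head is the latest repair, so dropping from the front keeps the `k` earliest repairs, whose
  -- charges do not depend on the dropped ones.
  refine ⟨l.drop (l.length - k), hl.sublist (List.drop_sublist _ _), by simp; omega,
    (repairCost_drop_le _ _ _ _ _).trans (h3.trans ?_)⟩
  have hin : ∀ σ : Fin T, ∑ x : StorageNode n T, (if IFGVertex.out x ∈ U ∧
      StorageNode.IsActive F σ x ∧ StorageNode.physical F x ∈ D (F σ) then β else 0)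
      = inflow D F β W σ := by
    intro σ
    rw [inflow]
    exact sum_congr rfl fun x _ => by simp [hWdef]
  simp only [hin, Fintype.sum_sum_type]
  rw [← add_assoc, add_add_add_comm, ← sum_add_distrib, ← sum_add_distrib]
  refine le_trans ?_ le_self_add
  refine add_le_add (sum_le_sum fun i _ => ?_) (sum_le_sum fun σ _ => ?_)
  · by_cases ha : IFGVertex.out (F := F) (k := k) (Sum.inl i) ∈ U <;>
    by_cases hb : IFGVertex.inp (F := F) (k := k) (Sum.inl i) ∈ U <;> simp [hWdef, ha, hb]
  · by_cases ha : IFGVertex.out (F := F) (k := k) (Sum.inr σ) ∈ U <;>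
    by_cases hb : IFGVertex.inp (F := F) (k := k) (Sum.inr σ) ∈ U <;> simp [hWdef, ha, hb]

open Classical in
/-- If the failing nodes are distinct, then some cut is at most the cut value of the sequence. -/
lemma exists_minCut_le {T : ℕ} (D : Fin n → Finset (Fin n)) (F : Fin T → Fin n)
    (hF : Function.Injective F) (α β : ℝ≥0∞) :
    ∃ t : DataCollector F T, minCut (ifgCapacity D F T α β) .source (.collector t) ≤
      ∑ τ : Fin T, min α ((D (F τ) \ (univ.filter (· < τ)).image F).card * β) := by
  have hact : ∀ x ∈ (univ : Finset (Fin T)).image (Sum.inr : Fin T → StorageNode n T),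
      StorageNode.IsActive F T x := by
    intro x hx
    obtain ⟨σ, -, rfl⟩ := mem_image.1 hx
    exact ⟨σ.2, fun ρ hρ _ he => hρ.ne (hF he).symm⟩
  let t : DataCollector F T :=
    ⟨univ.image Sum.inr, by rw [card_image_of_injective _ Sum.inr_injective]; simp, hact⟩
  refine ⟨t, ?_⟩
  let c : Fin T → ℝ≥0∞ := fun τ => (D (F τ) \ (univ.filter (· < τ)).image F).card * β
  -- All newcomer outputs are cut off. The input of a newcomer joins the source side exactly when
  -- cutting its `α` edge is cheaper than cutting its incoming edges. The other collectors stay on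
  -- the source side, so that their infinite edges are not cut.
  let U : Finset (IFGVertex F T) := univ.filter fun v => match v with
    | .source => True
    | .inp (Sum.inl _) => True
    | .out (Sum.inl _) => True
    | .inp (Sum.inr τ) => ¬ c τ ≤ α
    | .out (Sum.inr _) => False
    | .collector u => u ≠ t
  have hs : IFGVertex.source ∈ U := by simp [U]
  have ht : IFGVertex.collector t ∉ U := by simp [U]
  refine (iInf_le _ (⟨U, hs, ht⟩ :
    {U : Finset (IFGVertex F T) // .source ∈ U ∧ .collector t ∉ U})).trans ?_
  rw [cut_eq D F T α β U hs]
  have h1 : ∀ u : DataCollector F T, (if .collector u ∉ U then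
      ∑ x : StorageNode n T, (if .out x ∈ U ∧ x ∈ u.1 then (⊤ : ℝ≥0∞) else 0) else 0) = 0 := by
    intro u
    by_cases hu : u = t
    · subst hu
      simp [U, t]
    · simp [U, hu]
  have h2 : ∀ τ : Fin T, ∑ x : StorageNode n T, (if .out x ∈ U ∧ StorageNode.IsActive F τ x ∧
      StorageNode.physical F x ∈ D (F τ) then β else 0) ≤ c τ := by
    intro τ
    rw [← Finset.sum_filter, sum_const, nsmul_eq_mul]
    simp only [c]
    gcongr
    refine card_le_card_of_injOn (StorageNode.physical F) (fun x hx => ?_) (fun x hx y hy h => ?_)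
    · simp only [coe_filter, mem_univ, true_and, Set.mem_ofPred_eq] at hx
      rcases x with i | σ
      · simp only [coe_sdiff, Set.mem_sdiff, mem_coe, mem_image, mem_filter, mem_univ, true_and]
        refine ⟨hx.2.2, ?_⟩
        rintro ⟨σ, hσ, he⟩
        exact hx.2.1 σ hσ he
      · exact absurd hx.1 (by simp [U])
    · simp only [coe_filter, mem_univ, true_and, Set.mem_ofPred_eq] at hx hy
      exact hx.2.1.physical_injective hy.2.1 h
  simp only [h1, sum_const_zero, add_zero]
  simp only [Fintype.sum_sum_type]
  have h3 : ∀ i : Fin n, IFGVertex.inp (F := F) (k := T) (Sum.inl i) ∈ U := by simp [U]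
  have h4 : ∀ i : Fin n, IFGVertex.out (F := F) (k := T) (Sum.inl i) ∈ U := by simp [U]
  simp only [h3, h4, not_true_eq_false, if_false, false_and, sum_const_zero, zero_add]
  rw [← sum_add_distrib]
  refine sum_le_sum fun τ _ => ?_
  have h5 : IFGVertex.out (F := F) (k := T) (Sum.inr τ) ∉ U := by simp [U]
  have h2 := h2 τ
  rw [Fintype.sum_sum_type] at h2
  simp only [h4] at h2
  by_cases h : c τ ≤ α
  · have h6 : IFGVertex.inp (F := F) (k := T) (Sum.inr τ) ∉ U := by simp [U, h]
    simp only [h5, h6, not_false_eq_true, if_true, and_false, if_false, add_zero]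
    exact le_min (h2.trans h) h2
  · have h6 : IFGVertex.inp (F := F) (k := T) (Sum.inr τ) ∈ U := by simpa [U] using h
    simp only [h5, h6, not_false_eq_true, not_true_eq_false, if_true, and_true, if_false, zero_add]
    exact le_min le_rfl (not_le.1 h).le

lemma sum_min_eq_repairCost (D : Fin n → Finset (Fin n)) (α β : ℝ≥0∞) (r : ℕ → Fin n) (k : ℕ) :
    ∑ i ∈ range k, min α ((D (r i) \ (range i).image r).card * β) =
      repairCost D α β ((List.range k).map r).reverse := by
  induction k with
  | zero => simp [repairCost]
  | succ k ih =>
    rw [sum_range_succ, ih, List.range_succ, List.map_append, List.reverse_append]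
    have : ((List.range k).map r).reverse.toFinset = (range k).image r := by
      ext; simp
    simp [repairCost, this, add_comm]

lemma schemeMinCut_le (D : Fin n → Finset (Fin n)) (α β : ℝ≥0∞) (l : List (Fin n))
    (hl : l.Nodup) : schemeMinCut D l.length α β ≤ repairCost D α β l := by
  classical
  let F : Fin l.length → Fin n := fun i => l.reverse.get (i.cast (by simp))
  have hF : Function.Injective F := fun i j h => by
    have := List.nodup_iff_injective_get.1 (List.nodup_reverse.2 hl) h
    simpa using this
  obtain ⟨t, ht⟩ := exists_minCut_le D F hF α β
  rw [schemeMinCut]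
  refine iInf_le_of_le l.length ?_
  refine iInf_le_of_le F ?_
  refine iInf_le_of_le t (ht.trans (le_of_eq ?_))
  rcases Nat.eq_zero_or_pos l.length with h0 | h0
  · obtain rfl := List.length_eq_zero_iff.1 h0
    simp [repairCost]
  -- The value past the end is a dummy; it needs a nonempty list.
  let r : ℕ → Fin n := fun i => if h : i < l.length then F ⟨i, h⟩ else F ⟨0, h0⟩
  have hr : ((List.range l.length).map r).reverse = l := by
    rw [List.reverse_eq_iff]
    refine List.ext_getElem (by simp) fun i h1 h2 => ?_
    have : i < l.length := by simpa using h1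
    simp [r, this, F]
  conv_rhs => rw [← hr]
  rw [← sum_min_eq_repairCost, ← Fin.sum_univ_eq_sum_range
    (fun i => min α ((D (r i) \ (range i).image r).card * β))]
  refine sum_congr rfl fun τ _ => ?_
  have h1 : r τ = F τ := by simp [r]
  have h2 : (univ.filter (· < τ)).image F = (range τ).image r := by
    ext p
    simp only [mem_image, mem_filter, mem_univ, true_and, mem_range]
    constructor
    · rintro ⟨σ, hσ, rfl⟩
      exact ⟨σ, hσ, by simp [r]⟩
    · rintro ⟨i, hi, rfl⟩
      exact ⟨⟨i, hi.trans τ.2⟩, hi, by simp [r, hi.trans τ.2]⟩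
  rw [h1, h2]

/-- The two bounds on cuts combined; from here on no graph is needed. -/
lemma le_schemeMinCut_iff (D : Fin n → Finset (Fin n)) {k : ℕ} (hk : k ≤ n) (α β c : ℝ≥0∞) :
    c ≤ schemeMinCut D k α β ↔
      ∀ l : List (Fin n), l.Nodup → l.length = k → c ≤ repairCost D α β l := by
  constructor
  · rintro h l hl rfl
    exact h.trans (schemeMinCut_le D α β l hl)
  · intro h
    refine le_iInf fun T => le_iInf fun F => le_iInf fun t => ?_
    obtain ⟨l, hl, hlk, hle⟩ := exists_repairCost_le_cut D F k α β t ((List.finRange n).take k)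
      ((List.nodup_finRange n).sublist (List.take_sublist _ _)) (by simpa using hk)
    exact (h l hl hlk).trans hle

/-! ### The MBR point in terms of fresh helpers. -/

lemma repairCost_top (D : Fin n → Finset (Fin n)) (β : ℝ≥0∞) (l : List (Fin n)) :
    repairCost D ⊤ β l = freshHelpers D l * β := by
  induction l with
  | nil => simp [repairCost, freshHelpers]
  | cons x l ih => rw [repairCost, freshHelpers, ih, top_inf_eq]; push_cast; rw [add_mul]

lemma repairCost_mul_eq {d : ℕ} {D : Fin n → Finset (Fin n)} (hD : ∀ x, (D x).card ≤ d)
    (β : ℝ≥0∞) (l : List (Fin n)) : repairCost D (d * β) β l = freshHelpers D l * β := by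
  induction l with
  | nil => simp [repairCost, freshHelpers]
  | cons x l ih =>
    rw [repairCost, freshHelpers, ih, min_eq_right]
    · push_cast; rw [add_mul]
    · gcongr
      exact (card_le_card sdiff_subset).trans (hD x)

/-- The last entry of the list is repaired first, with all `d` helpers fresh, so its charge drops
from `d * β` to `α`; no other charge exceeds its fresh traffic. -/
lemma repairCost_lt_of_lt {d : ℕ} {D : Fin n → Finset (Fin n)} (hD : ∀ x, (D x).card = d)
    {α β : ℝ≥0} (h : α < d * β) (l : List (Fin n)) (hl : l ≠ []) :
    repairCost D α β l < freshHelpers D l * β := by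
  induction l with
  | nil => exact absurd rfl hl
  | cons x l ih =>
    rw [repairCost, freshHelpers]
    push_cast
    rw [add_mul]
    rcases eq_or_ne l [] with rfl | hne
    · have h' : (α : ℝ≥0∞) < d * β := by exact_mod_cast h
      simpa [repairCost, freshHelpers, hD] using h'
    · refine ENNReal.add_lt_add_of_le_of_lt ?_ (min_le_right _ _) (ih hne)
      exact ((min_le_left _ _).trans_lt ENNReal.coe_lt_top).ne

lemma le_freshHelpers {d : ℕ} {D : Fin n → Finset (Fin n)} (hD : ∀ x, (D x).card = d)
    (l : List (Fin n)) (hl : l ≠ []) : d ≤ freshHelpers D l := by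
  induction l with
  | nil => exact absurd rfl hl
  | cons x l ih =>
    rw [freshHelpers]
    rcases eq_or_ne l [] with rfl | hne
    · simp [hD]
    · exact (ih hne).trans (Nat.le_add_left _ _)

/-- The MBR point of a scheme with `d` helpers per node. -/
lemma isMBRPoint_of_isLeast {d k m : ℕ} {D : Fin n → Finset (Fin n)} (hD : ∀ x, (D x).card = d)
    (hd : 1 ≤ d) (hk : 1 ≤ k) (hkn : k ≤ n)
    (hm : IsLeast {c | ∃ l : List (Fin n), l.Nodup ∧ l.length = k ∧ freshHelpers D l = c} m)
    (M : ℝ≥0) : 0 < m ∧ IsMBRPoint D k M (d * (M / m)) (M / m) := by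
  obtain ⟨⟨l₀, hl₀, hlk₀, hf₀⟩, hmin⟩ := hm
  have hne : l₀ ≠ [] := by rintro rfl; simp at hlk₀; omega
  have hm0 : 0 < m := by
    have := le_freshHelpers hD l₀ hne
    omega
  have hm0' : (m : ℝ≥0) ≠ 0 := by exact_mod_cast hm0.ne'
  have hle : ∀ l : List (Fin n), l.Nodup → l.length = k → m ≤ freshHelpers D l :=
    fun l h1 h2 => hmin ⟨l, h1, h2, rfl⟩
  have hmul : ∀ b : ℝ≥0, (∀ l : List (Fin n), l.Nodup → l.length = k →
      (M : ℝ≥0∞) ≤ freshHelpers D l * (b : ℝ≥0∞)) ↔ M ≤ m * b := by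
    intro b
    constructor
    · intro h
      have := h l₀ hl₀ hlk₀
      rw [hf₀] at this
      exact_mod_cast this
    · intro h l h1 h2
      have : M ≤ freshHelpers D l * b := h.trans (by gcongr; exact hle l h1 h2)
      exact_mod_cast this
  have hM : (m : ℝ≥0) * (M / m) = M := mul_div_cancel₀ M hm0'
  refine ⟨hm0, ⟨?_, ?_⟩, ⟨?_, ?_⟩⟩
  · simp only [Set.mem_ofPred_eq, Satisfies, le_schemeMinCut_iff D hkn, repairCost_top, hmul]
    exact hM.ge
  · intro b hb
    simp only [Set.mem_ofPred_eq, Satisfies, le_schemeMinCut_iff D hkn, repairCost_top, hmul] at hb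
    rw [div_le_iff₀' (by positivity)]
    exact hb
  · have := repairCost_mul_eq (fun x => (hD x).le) ((M / m : ℝ≥0) : ℝ≥0∞)
    simp only [Set.mem_ofPred_eq, Satisfies, le_schemeMinCut_iff D hkn, ENNReal.coe_mul,
      ENNReal.coe_natCast, this, hmul]
    exact hM.ge
  · intro a ha
    simp only [Set.mem_ofPred_eq, Satisfies, le_schemeMinCut_iff D hkn] at ha
    -- With less storage the minimizing list `l₀` would already cost less than `m * (M / m) = M`.
    by_contra hlt
    have h1 := repairCost_lt_of_lt hD (not_le.1 hlt) l₀ hne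
    have h2 := (ha l₀ hl₀ hlk₀).trans_lt h1
    rw [hf₀] at h2
    have h3 : M < m * (M / m) := by exact_mod_cast h2
    exact absurd h3 (by rw [hM]; exact lt_irrefl _)

lemma exists_isLeast_freshHelpers (D : Fin n → Finset (Fin n)) {k : ℕ} (hkn : k ≤ n) :
    ∃ m, IsLeast {c | ∃ l : List (Fin n), l.Nodup ∧ l.length = k ∧ freshHelpers D l = c} m := by
  classical
  have hne : ∃ c, ∃ l : List (Fin n), l.Nodup ∧ l.length = k ∧ freshHelpers D l = c :=
    ⟨_, (List.finRange n).take k,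
      (List.nodup_finRange n).sublist (List.take_sublist _ _), by simpa using hkn, rfl⟩
  exact ⟨Nat.find hne, Nat.find_spec hne, fun c hc => Nat.find_min' hne hc⟩

/-! ### Helper sets of the family-plus scheme -/

lemma card_familyHelpers {N d i : ℕ} (hdN : d < N) : (familyHelpers N d i).card = d := by
  rw [familyHelpers]
  split_ifs with h
  · have hw : 0 < N - d := by omega
    have h1 : (range N).filter (fun j => j / (N - d) ≠ i / (N - d)) =
        range N \ Ico (i / (N - d) * (N - d)) ((i / (N - d) + 1) * (N - d)) := by
      ext j
      simp only [mem_filter, mem_sdiff, mem_range, mem_Ico, ne_eq, Nat.div_eq_iff hw]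
      have : (i / (N - d) + 1) * (N - d) = i / (N - d) * (N - d) + (N - d) := by ring
      omega
    have h2 : (i / (N - d) + 1) * (N - d) ≤ N :=
      (Nat.mul_le_mul_right _ h).trans (Nat.div_mul_le_self _ _)
    rw [h1, card_sdiff_of_subset]
    · rw [card_range, Nat.card_Ico, ← Nat.sub_mul, Nat.add_sub_cancel_left, one_mul]
      omega
    · intro j hj
      simp only [mem_Ico, mem_range] at hj ⊢
      omega
  · simp

lemma lt_of_mem_familyHelpers {N d i j : ℕ} (hdN : d < N) (h : j ∈ familyHelpers N d i) :
    j < N := by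
  rw [familyHelpers] at h
  split_ifs at h <;> simp at h <;> omega

lemma two_mul_mul_numRegular_le (n d : ℕ) : 2 * d * numRegular n d ≤ n := by
  refine (Nat.mul_le_mul_left _ ?_).trans (Nat.mul_div_le n (2 * d))
  rw [numRegular]
  split_ifs
  · exact le_rfl
  · exact Nat.sub_le _ _

lemma groupStart_add_groupSize_le (n d i : ℕ) : groupStart n d i + groupSize n d i ≤ n := by
  have h := two_mul_mul_numRegular_le n d
  rw [groupStart, groupSize]
  split_ifs with hi
  · rw [min_eq_left hi.le]
    refine le_trans ?_ h
    rw [← Nat.mul_succ]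
    exact Nat.mul_le_mul_left _ hi
  · rw [min_eq_right (not_lt.1 hi), remainingSize]
    omega

lemma mul_numRegular_of_mod_eq_zero {n d : ℕ} (h : n % (2 * d) = 0) :
    2 * d * numRegular n d = n := by
  rw [numRegular, if_pos h]
  have := Nat.div_add_mod n (2 * d)
  omega

lemma mul_numRegular_of_mod_ne_zero {n d : ℕ} (h : n % (2 * d) ≠ 0) (hn : 2 * d ≤ n) (hd : 1 ≤ d) :
    2 * d * numRegular n d + 2 * d + n % (2 * d) = n := by
  rw [numRegular, if_neg h]
  have h1 := Nat.div_add_mod n (2 * d)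
  have h2 : 1 ≤ n / (2 * d) := (Nat.one_le_div_iff (by omega)).2 hn
  have h3 : 2 * d * (n / (2 * d) - 1) + 2 * d = 2 * d * (n / (2 * d)) := by
    rw [← Nat.mul_succ, Nat.succ_eq_add_one, Nat.sub_add_cancel h2]
  omega

/-- The family scheme needs more than `d` nodes in each group. When `n < 2 * d` the only group is
everything, and `hdn` suffices. -/
lemma lt_groupSize {n d i : ℕ} (hd : 1 ≤ d) (hdn : d < n) (hi : i < n) :
    d < groupSize n d i := by
  rw [groupSize]
  split_ifs with h
  · omega
  · by_cases hmod : n % (2 * d) = 0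
    · have h1 := mul_numRegular_of_mod_eq_zero hmod
      refine absurd ((Nat.div_lt_iff_lt_mul (by omega)).2 ?_) h
      rw [mul_comm]
      omega
    · rw [remainingSize]
      by_cases hn : 2 * d ≤ n
      · have := mul_numRegular_of_mod_ne_zero hmod hn hd
        omega
      · have : numRegular n d = 0 := by
          rw [numRegular, if_neg hmod, Nat.div_eq_of_lt (by omega)]
        rw [this]
        omega

lemma card_familyPlus {d : ℕ} (hd : 1 ≤ d) (hdn : d < n) (i : Fin n) :
    (familyPlus n d i).card = d := by
  have h := lt_groupSize hd hdn i.2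
  have h' := groupStart_add_groupSize_le n d i
  refine Eq.trans ?_ (card_familyHelpers (i := i - groupStart n d i) h)
  refine card_bij' (fun j _ => (j : ℕ) - groupStart n d i)
    (fun j hj => ⟨groupStart n d i + j, ?_⟩) ?_ ?_ ?_ ?_
  · have := lt_of_mem_familyHelpers h hj
    omega
  · intro j hj
    exact (mem_filter.1 hj).2.2
  · intro j hj
    simpa [familyPlus] using hj
  · intro j hj
    have := (mem_filter.1 hj).2.1
    ext
    simp only
    omega
  · intro j hj
    simp

/-! ### The number of fresh helpers in one group -/

/-- The least number of fresh helpers in the repairs of `j` nodes of one group. -/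
def groupFresh (d j : ℕ) : ℕ := ∑ i ∈ range j, (d - (i + 1) / 2)

/-- The least number of fresh helpers in the repairs of `K` nodes of regular groups. -/
def regularFresh (d K : ℕ) : ℕ := ∑ i ∈ range K, (d - (i % (2 * d) + 1) / 2)

lemma groupFresh_zero (d : ℕ) : groupFresh d 0 = 0 := rfl

lemma groupFresh_succ (d j : ℕ) : groupFresh d (j + 1) = groupFresh d j + (d - (j + 1) / 2) :=
  sum_range_succ _ _

lemma groupFresh_mono (d : ℕ) : Monotone (groupFresh d) := fun _ _ h =>
  sum_le_sum_of_subset (range_mono h)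

lemma regularFresh_mono (d : ℕ) : Monotone (regularFresh d) := fun _ _ h =>
  sum_le_sum_of_subset (range_mono h)

lemma groupFresh_two_mul {d m : ℕ} (h : m ≤ d) : groupFresh d (2 * m) + m * m = 2 * m * d := by
  induction m with
  | zero => simp [groupFresh]
  | succ m ih =>
    have ih := ih (by omega)
    obtain ⟨e, rfl⟩ := Nat.exists_eq_add_of_le h
    rw [show 2 * (m + 1) = 2 * m + 1 + 1 by ring, groupFresh_succ, groupFresh_succ,
      show (2 * m + 1) / 2 = m by omega, show (2 * m + 1 + 1) / 2 = m + 1 by omega,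
      show m + 1 + e - m = e + 1 by omega, show m + 1 + e - (m + 1) = e by omega]
    nlinarith

lemma groupFresh_two_mul_add_one {d m : ℕ} (h : m ≤ d) :
    groupFresh d (2 * m + 1) + m * m + m = (2 * m + 1) * d := by
  have := groupFresh_two_mul h
  rw [groupFresh_succ, show (2 * m + 1) / 2 = m by omega]
  have : d - m + m = d := Nat.sub_add_cancel h
  linarith

/-- The summands vanish from index `2 * d - 1` on, thanks to truncated subtraction. -/
lemma groupFresh_of_le {d j : ℕ} (h : 2 * d - 1 ≤ j) : groupFresh d j = d * d := by
  have h2 : groupFresh d (2 * d) = d * d := by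
    have := groupFresh_two_mul (le_refl d)
    linarith
  have h1 : ∀ i, groupFresh d (2 * d - 1 + i) = groupFresh d (2 * d - 1) := by
    intro i
    induction i with
    | zero => rfl
    | succ i ih => rw [← add_assoc, groupFresh_succ, ih,
      show d - (2 * d - 1 + i + 1) / 2 = 0 by omega, add_zero]
  obtain ⟨i, rfl⟩ := Nat.exists_eq_add_of_le h
  rw [h1, ← h2]
  rcases Nat.eq_zero_or_pos d with rfl | hd
  · rfl
  · rw [← h1 1, Nat.sub_add_cancel (by omega)]

lemma groupFresh_le (d j : ℕ) : groupFresh d j ≤ d * d :=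
  (groupFresh_mono d (Nat.le_add_right j (2 * d))).trans (groupFresh_of_le (by omega)).le

/-- A set of `b` and `c` nodes in the two sides of a group cannot have fewer fresh helpers than the
optimal sequence. -/
lemma groupFresh_add_mul_le {d b c : ℕ} (hb : b ≤ d) :
    groupFresh d (b + c) + b * c ≤ d * (b + c) := by
  rcases le_total (2 * d) (b + c) with h | h
  -- The difference of the two sides is `(d - b) * (c - d)`, with both factors nonnegative.
  · rw [groupFresh_of_le (by omega)]
    obtain ⟨e, rfl⟩ := Nat.exists_eq_add_of_le hb
    obtain ⟨f, rfl⟩ : ∃ f, c = b + e + e + f := ⟨c - (b + e + e), by omega⟩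
    nlinarith
  -- In this range `groupFresh d j` is `d * j` minus the integer part of `j ^ 2 / 4`, which bounds
  -- `b * c` for `j = b + c`.
  · rcases Nat.even_or_odd' (b + c) with ⟨m, hm | hm⟩
    · have := groupFresh_two_mul (d := d) (m := m) (by omega)
      rw [hm]
      have h2 : b * c ≤ m * m := by
        zify at hm ⊢
        nlinarith [sq_nonneg ((b : ℤ) - c)]
      linarith
    · have := groupFresh_two_mul_add_one (d := d) (m := m) (by omega)
      rw [hm]
      have h2 : b * c ≤ m * m + m := by
        zify at hm ⊢
        nlinarith [sq_nonneg ((b : ℤ) - c)]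
      linarith

lemma groupFresh_add_le (d a b : ℕ) : groupFresh d (a + b) ≤ groupFresh d a + groupFresh d b := by
  rw [groupFresh, sum_range_add]
  refine Nat.add_le_add_left (sum_le_sum fun i _ => ?_) _
  omega

/-- Moving `b - s` repairs from the second group fills the first one. Since `s ≤ a`, each moved
repair lands at a position that is no earlier, where the marginal cost is no larger. -/
lemma groupFresh_exchange {d a b s : ℕ} (h : a + b = 2 * d + s) (ha : a ≤ 2 * d)
    (hb : b ≤ 2 * d) :
    d * d + groupFresh d s ≤ groupFresh d a + groupFresh d b := by
  have h1 : groupFresh d a + ∑ i ∈ range (b - s), (d - (a + i + 1) / 2) = d * d := by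
    rw [← groupFresh_of_le (show 2 * d - 1 ≤ 2 * d by omega), show 2 * d = a + (b - s) by omega,
      groupFresh, groupFresh, sum_range_add]
  have h2 : groupFresh d b = groupFresh d s + ∑ i ∈ range (b - s), (d - (s + i + 1) / 2) := by
    conv_lhs => rw [show b = s + (b - s) by omega, groupFresh, sum_range_add]
    rw [groupFresh]
  have h3 : ∑ i ∈ range (b - s), (d - (a + i + 1) / 2) ≤
      ∑ i ∈ range (b - s), (d - (s + i + 1) / 2) := sum_le_sum fun i _ => by omega
  omega

lemma regularFresh_add_two_mul (d b : ℕ) :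
    regularFresh d (2 * d + b) = d * d + regularFresh d b := by
  rw [regularFresh, sum_range_add, regularFresh]
  congr 1
  · rw [← groupFresh_of_le (show 2 * d - 1 ≤ 2 * d by omega), groupFresh]
    refine sum_congr rfl fun i hi => ?_
    rw [Nat.mod_eq_of_lt (mem_range.1 hi)]
  · simp

lemma regularFresh_eq_groupFresh {d r : ℕ} (h : r ≤ 2 * d) :
    regularFresh d r = groupFresh d r := by
  refine sum_congr rfl fun i hi => ?_
  rw [Nat.mod_eq_of_lt ((mem_range.1 hi).trans_le h)]

lemma regularFresh_mul_add (d q b : ℕ) :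
    regularFresh d (2 * d * q + b) = d * d * q + regularFresh d b := by
  induction q with
  | zero => simp
  | succ q ih =>
    rw [show 2 * d * (q + 1) + b = 2 * d + (2 * d * q + b) by ring, regularFresh_add_two_mul, ih]
    ring

lemma regularFresh_eq {d : ℕ} (hd : 1 ≤ d) (K : ℕ) :
    regularFresh d K = d * d * (K / (2 * d)) + groupFresh d (K % (2 * d)) := by
  conv_lhs => rw [← Nat.div_add_mod K (2 * d)]
  rw [regularFresh_mul_add, regularFresh_eq_groupFresh (Nat.mod_lt _ (by omega)).le]

/-- Full groups split off from `b`, leaving two partial groups: they are merged if they fit into one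
group, and exchanged otherwise. -/
lemma regularFresh_add_le {d a : ℕ} (hd : 1 ≤ d) (ha : a ≤ 2 * d) (b : ℕ) :
    regularFresh d (a + b) ≤ groupFresh d a + regularFresh d b := by
  have hr := Nat.mod_lt b (show 2 * d > 0 by omega)
  rw [← Nat.div_add_mod b (2 * d), add_left_comm, regularFresh_mul_add, regularFresh_mul_add,
    regularFresh_eq_groupFresh hr.le]
  suffices h : regularFresh d (a + b % (2 * d)) ≤ groupFresh d a + groupFresh d (b % (2 * d)) by
    omega
  rcases le_total (a + b % (2 * d)) (2 * d) with h | h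
  · rw [regularFresh_eq_groupFresh h]
    exact groupFresh_add_le _ _ _
  · obtain ⟨s, hs⟩ := Nat.exists_eq_add_of_le h
    rw [hs, regularFresh_add_two_mul, regularFresh_eq_groupFresh (by omega)]
    exact groupFresh_exchange hs ha hr.le

lemma groupFresh_le_regularFresh (d k : ℕ) : groupFresh d k ≤ regularFresh d k := by
  rcases le_total k (2 * d) with h | h
  · rw [regularFresh_eq_groupFresh h]
  · obtain ⟨s, rfl⟩ := Nat.exists_eq_add_of_le h
    rw [regularFresh_add_two_mul]
    exact (groupFresh_le _ _).trans (Nat.le_add_right _ _)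

lemma regularFresh_sum_le {d : ℕ} (hd : 1 ≤ d) (K : ℕ → ℕ) (R : ℕ) (hK : ∀ g < R, K g ≤ 2 * d) :
    regularFresh d (∑ g ∈ range R, K g) ≤ ∑ g ∈ range R, groupFresh d (K g) := by
  induction R with
  | zero => simp [regularFresh]
  | succ R ih =>
    rw [sum_range_succ, sum_range_succ, add_comm, add_comm _ (groupFresh d (K R))]
    exact (regularFresh_add_le hd (hK R (Nat.lt_succ_self R)) _).trans
      (Nat.add_le_add_left (ih fun g hg => hK g (hg.trans (Nat.lt_succ_self R))) _)

/-- Repairing as many nodes of the remaining group as possible is optimal. -/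
lemma groupFresh_min_add_le {d j K N : ℕ} (hd : 1 ≤ d) (hj : j ≤ N) (hN : N = 0 ∨ 2 * d ≤ N) :
    groupFresh d (min (j + K) N) + regularFresh d (j + K - N)
      ≤ groupFresh d j + regularFresh d K := by
  rcases hN with rfl | hN
  · obtain rfl : j = 0 := by omega
    simp
  · rcases le_total j (2 * d) with h | h
    -- A share of at most `2 * d` costs as much as in a regular group, so all repairs can first be
    -- packed into regular groups.
    · refine le_trans ?_ (regularFresh_add_le hd h K)
      rcases le_total (j + K) N with hk | hk
      · rw [min_eq_left hk, Nat.sub_eq_zero_of_le hk]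
        exact groupFresh_le_regularFresh _ _
      · obtain ⟨s, hs⟩ := Nat.exists_eq_add_of_le (hN.trans hk)
        rw [hs, regularFresh_add_two_mul]
        exact Nat.add_le_add (groupFresh_le _ _) (regularFresh_mono _ (by omega))
    · rw [groupFresh_of_le (show 2 * d - 1 ≤ j by omega)]
      exact Nat.add_le_add (groupFresh_le _ _) (regularFresh_mono _ (by omega))

/-! ### Lower bound -/

/-- A helper that is not fresh gives a pair of list entries on opposite sides, and the pair is
charged only to its later repair. There are `l.countP B * l.countP (fun x => !B x)` such pairs. -/
lemma mul_length_le_freshHelpers {d : ℕ} {D : Fin n → Finset (Fin n)}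
    (hD : ∀ x, (D x).card = d) (B : Fin n → Bool) (hB : ∀ x, ∀ y ∈ D x, B y = !B x)
    (l : List (Fin n)) :
    d * l.length ≤ freshHelpers D l + l.countP B * l.countP (fun x => !B x) := by
  induction l with
  | nil => simp
  | cons x l ih =>
    have h1 : (D x \ l.toFinset).card + (D x ∩ l.toFinset).card = d := by
      rw [card_sdiff_add_card_inter, hD]
    have h2 : (D x ∩ l.toFinset).card ≤ l.countP (fun y => B y == !B x) := by
      rw [List.countP_eq_length_filter]
      refine (card_le_card fun y hy => ?_).trans (List.toFinset_card_le _)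
      rw [mem_inter, List.mem_toFinset] at hy
      simp [hy.2, hB x y hy.1]
    rw [freshHelpers, List.length_cons]
    cases hx : B x
    · simp only [hx, Bool.not_false, beq_true] at h2
      simp only [List.countP_cons, hx, Bool.not_false, if_true, Bool.false_eq_true, if_false]
      nlinarith
    · simp only [hx, Bool.not_true, beq_false] at h2
      simp only [List.countP_cons, hx, Bool.not_true, if_true, Bool.false_eq_true, if_false]
      nlinarith

lemma groupFresh_length_le {d : ℕ} {D : Fin n → Finset (Fin n)}
    (hD : ∀ x, (D x).card = d) (B : Fin n → Bool) (hB : ∀ x, ∀ y ∈ D x, B y = !B x)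
    (l : List (Fin n)) (hl : l.countP B ≤ d) : groupFresh d l.length ≤ freshHelpers D l := by
  have h1 := mul_length_le_freshHelpers hD B hB l
  have h2 := groupFresh_add_mul_le (c := l.countP (fun x => !B x)) hl
  have h3 : l.length = l.countP B + l.countP (fun x => !B x) := by
    simpa using List.length_eq_countP_add_countP (p := B) (l := l)
  rw [h3] at h1 ⊢
  omega

/-- Repairs in other groups never spoil a helper, so the groups decouple. -/
lemma freshHelpers_eq_sum {D : Fin n → Finset (Fin n)} (gr : Fin n → ℕ)
    (hgr : ∀ x, ∀ y ∈ D x, gr y = gr x) (R : ℕ) (hR : ∀ x, gr x ≤ R) (l : List (Fin n)) :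
    freshHelpers D l = ∑ g ∈ range (R + 1), freshHelpers D (l.filter fun x => gr x = g) := by
  induction l with
  | nil => simp [freshHelpers]
  | cons x l ih =>
    have h : ∀ g, freshHelpers D ((x :: l).filter fun x => gr x = g) =
        (if gr x = g then (D x \ l.toFinset).card else 0)
          + freshHelpers D (l.filter fun x => gr x = g) := by
      intro g
      by_cases hg : gr x = g
      · rw [List.filter_cons_of_pos (by simpa using hg), freshHelpers, if_pos hg]
        congr 2
        ext y
        simp only [mem_sdiff, List.mem_toFinset, List.mem_filter, decide_eq_true_eq, not_and]
        constructor
        · exact fun ⟨hy, hyl⟩ => ⟨hy, fun hyl' => hyl hyl' ((hgr x y hy).trans hg)⟩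
        · exact fun ⟨hy, hyl⟩ => ⟨hy, fun hyl' => absurd hyl' hyl⟩
      · rw [List.filter_cons_of_neg (by simpa using hg), if_neg hg, zero_add]
    simp only [h, sum_add_distrib, ← ih]
    rw [freshHelpers, sum_ite_eq, if_pos (mem_range.2 (Nat.lt_succ_of_le (hR x)))]

lemma length_eq_sum (gr : Fin n → ℕ) (R : ℕ) (hR : ∀ x, gr x ≤ R) (l : List (Fin n)) :
    l.length = ∑ g ∈ range (R + 1), (l.filter fun x => gr x = g).length := by
  induction l with
  | nil => simp
  | cons x l ih =>
    have h : ∀ g, ((x :: l).filter fun x => gr x = g).length =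
        (if gr x = g then 1 else 0) + (l.filter fun x => gr x = g).length := by
      intro g
      by_cases hg : gr x = g
      · rw [List.filter_cons_of_pos (by simpa using hg), if_pos hg, List.length_cons, add_comm]
      · rw [List.filter_cons_of_neg (by simpa using hg), if_neg hg, zero_add]
    simp only [h, sum_add_distrib, ← ih]
    rw [sum_ite_eq, if_pos (mem_range.2 (Nat.lt_succ_of_le (hR x))), List.length_cons, add_comm]

lemma length_le_card_of_nodup {l : List (Fin n)} (hl : l.Nodup) (s : Finset (Fin n))
    (h : ∀ x ∈ l, x ∈ s) : l.length ≤ s.card := by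
  rw [← List.toFinset_card_of_nodup hl]
  exact card_le_card fun x hx => h x (List.mem_toFinset.1 hx)

/-- The lower bound for schemes that consist of `R` groups of at most `2 * d` nodes and of one group
of at most `N` nodes, if the helpers of a node lie on the other side of its group. -/
lemma groupFresh_add_le_freshHelpers {d N R : ℕ} {D : Fin n → Finset (Fin n)} (hd : 1 ≤ d)
    (hD : ∀ x, (D x).card = d) (B : Fin n → Bool) (hB : ∀ x, ∀ y ∈ D x, B y = !B x)
    (gr : Fin n → ℕ) (hgr : ∀ x, ∀ y ∈ D x, gr y = gr x) (hR : ∀ x, gr x ≤ R)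
    (hBd : ∀ g, (univ.filter fun x => gr x = g ∧ B x).card ≤ d)
    (hcard : ∀ g < R, (univ.filter fun x => gr x = g).card ≤ 2 * d)
    (hN : N = 0 ∨ 2 * d ≤ N) (hcardR : (univ.filter fun x => gr x = R).card ≤ N)
    (l : List (Fin n)) (hl : l.Nodup) :
    groupFresh d (min l.length N) + regularFresh d (l.length - N) ≤ freshHelpers D l := by
  have hlen : ∀ g, (l.filter fun x => gr x = g).length ≤ (univ.filter fun x => gr x = g).card :=
    fun g => length_le_card_of_nodup (hl.filter _) _ fun x hx => by
      simpa using (List.mem_filter.1 hx).2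
  have hsum := length_eq_sum gr R hR l
  rw [sum_range_succ, add_comm] at hsum
  rw [hsum]
  refine (groupFresh_min_add_le hd ((hlen R).trans hcardR) hN).trans ?_
  rw [freshHelpers_eq_sum gr hgr R hR l, sum_range_succ, add_comm]
  have hle : ∀ g, groupFresh d (l.filter fun x => gr x = g).length ≤
      freshHelpers D (l.filter fun x => gr x = g) := by
    intro g
    refine groupFresh_length_le hD B hB _ ?_
    rw [List.countP_eq_length_filter]
    refine (length_le_card_of_nodup ((hl.filter _).filter _) _ fun x hx => ?_).trans (hBd g)
    rw [List.mem_filter, List.mem_filter] at hx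
    simpa [hx.2] using hx.1.2
  exact Nat.add_le_add ((regularFresh_sum_le hd _ R fun g hg => (hlen g).trans (hcard g hg)).trans
    (sum_le_sum fun g _ => hle g)) (hle R)

/-! ### The two sides of a group -/

/-- For `N = 2 * d` there are two complete families; for larger `N` there is one complete family of
`N - d` nodes and an incomplete one of `d` nodes. Both cases have the same two-sided form. -/
lemma mem_familyHelpers_iff {N d o m : ℕ} (hd : 1 ≤ d) (h1 : 2 * d ≤ N) (ho : o < N) :
    m ∈ familyHelpers N d o ↔ if o < N - d then N - d ≤ m ∧ m < N else m < d := by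
  have hw : 0 < N - d := by omega
  by_cases h : o < N - d
  · have hN : 0 < N / (N - d) := Nat.div_pos (Nat.sub_le _ _) hw
    rw [familyHelpers, Nat.div_eq_of_lt h, if_pos hN, if_pos h]
    simp only [mem_filter, mem_range, ne_eq, Nat.div_eq_zero_iff]
    omega
  · have ho1 : o / (N - d) = 1 := by
      rw [Nat.div_eq_iff hw]
      omega
    rw [familyHelpers, ho1, if_neg h]
    split_ifs with h2
    · rw [Nat.lt_div_iff_mul_lt hw] at h2
      obtain rfl : N = 2 * d := by omega
      simp only [mem_filter, mem_range, ne_eq, Nat.div_eq_iff hw]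
      omega
    · simp

/-- The index of the group of a node. -/
def groupIndex (n d i : ℕ) : ℕ := min (i / (2 * d)) (numRegular n d)

lemma groupStart_eq (n d i : ℕ) : groupStart n d i = 2 * d * groupIndex n d i := rfl

lemma groupSize_eq (n d i : ℕ) : groupSize n d i =
    if groupIndex n d i < numRegular n d then 2 * d else remainingSize n d := by
  simp [groupSize, groupIndex]

lemma groupIndex_eq_of_lt {d i g : ℕ} (hd : 1 ≤ d) (hg : g < numRegular n d) :
    groupIndex n d i = g ↔ 2 * d * g ≤ i ∧ i < 2 * d * g + 2 * d := by
  have : groupIndex n d i = g ↔ i / (2 * d) = g := by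
    rw [groupIndex]
    omega
  rw [this, Nat.div_eq_iff (by omega), mul_comm g]
  omega

lemma groupIndex_eq_numRegular {d i : ℕ} (hd : 1 ≤ d) :
    groupIndex n d i = numRegular n d ↔ 2 * d * numRegular n d ≤ i := by
  rw [groupIndex, min_eq_right_iff, Nat.le_div_iff_mul_le (by omega), mul_comm]

lemma groupIndex_le (n d i : ℕ) : groupIndex n d i ≤ numRegular n d := min_le_right _ _

lemma remainingSize_add (n d : ℕ) : 2 * d * numRegular n d + remainingSize n d = n := by
  have := two_mul_mul_numRegular_le n d
  rw [remainingSize]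
  omega

lemma remainingSize_eq_zero {d : ℕ} (h : n % (2 * d) = 0) : remainingSize n d = 0 := by
  have := mul_numRegular_of_mod_eq_zero h
  rw [remainingSize]
  omega

lemma two_mul_le_remainingSize {d : ℕ} (h : n % (2 * d) ≠ 0) (hn : 2 * d ≤ n) (hd : 1 ≤ d) :
    2 * d ≤ remainingSize n d := by
  have := mul_numRegular_of_mod_ne_zero h hn hd
  rw [remainingSize]
  omega

lemma groupIndex_eq_iff {d i g : ℕ} (hd : 1 ≤ d) (hi : i < n) (hg : g ≤ numRegular n d) :
    groupIndex n d i = g ↔ 2 * d * g ≤ i ∧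
      i < 2 * d * g + (if g < numRegular n d then 2 * d else remainingSize n d) := by
  split_ifs with h
  · exact groupIndex_eq_of_lt hd h
  · obtain rfl : g = numRegular n d := by omega
    rw [groupIndex_eq_numRegular hd]
    have := remainingSize_add n d
    omega

lemma two_mul_le_groupSize {d i : ℕ} (hd : 1 ≤ d) (hn : 2 * d ≤ n) (hi : i < n) :
    2 * d ≤ groupSize n d i := by
  by_cases hmod : n % (2 * d) = 0
  · have h1 := mul_numRegular_of_mod_eq_zero hmod
    rw [groupSize, if_pos]
    rw [Nat.div_lt_iff_lt_mul (by omega), mul_comm]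
    omega
  · have := two_mul_le_remainingSize hmod hn hd
    rw [groupSize]
    split_ifs <;> omega

/-- The node lies in the second side of its group, that is, among its last `d` nodes. -/
def isSecond (n d i : ℕ) : Bool := decide (groupStart n d i + groupSize n d i ≤ i + d)

lemma mem_familyPlus_iff {d : ℕ} (hd : 1 ≤ d) (hn : 2 * d ≤ n) (i j : Fin n) :
    j ∈ familyPlus n d i ↔ groupIndex n d j = groupIndex n d i ∧
      if isSecond n d i then (j : ℕ) < groupStart n d i + d else isSecond n d j := by
  have hN := two_mul_le_groupSize hd hn i.2
  have hi := (groupIndex_eq_iff hd i.2 (groupIndex_le n d i)).1 rfl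
  have hj := groupIndex_eq_iff hd j.2 (groupIndex_le n d i)
  rw [← groupStart_eq, ← groupSize_eq] at hi hj
  rw [familyPlus, mem_filter, mem_familyHelpers_iff hd hN (by omega)]
  by_cases hg : groupIndex n d j = groupIndex n d i
  · have h1 := hj.1 hg
    have h2 : groupStart n d j = groupStart n d i := by rw [groupStart_eq, groupStart_eq, hg]
    have h3 : groupSize n d j = groupSize n d i := by rw [groupSize_eq, groupSize_eq, hg]
    simp only [isSecond, h2, h3, decide_eq_true_eq, hg, mem_univ, true_and]
    split_ifs <;> omega
  · simp only [hg, false_and, mem_univ, true_and, iff_false]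
    rw [hj] at hg
    split_ifs <;> omega

lemma card_filter_fin_le (p : Fin n → Prop) [DecidablePred p] (a b : ℕ)
    (h : ∀ x, p x → a ≤ (x : ℕ) ∧ (x : ℕ) < a + b) : (univ.filter p).card ≤ b := by
  have : (univ.filter p).card ≤ (Ico a (a + b)).card := by
    refine card_le_card_of_injOn (fun x => (x : ℕ)) (fun x hx => ?_) fun x _ y _ h => Fin.ext h
    simpa using h x (by simpa using hx)
  simpa using this

/-- The least number of fresh helpers in the repairs of `k` nodes. -/
def planFresh (n d k : ℕ) : ℕ :=
  groupFresh d (min k (remainingSize n d)) + regularFresh d (k - remainingSize n d)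

lemma planFresh_le_freshHelpers {d : ℕ} (hd : 1 ≤ d) (hdn : d < n) (hn : 2 * d ≤ n)
    (l : List (Fin n)) (hl : l.Nodup) :
    planFresh n d l.length ≤ freshHelpers (familyPlus n d) l := by
  refine groupFresh_add_le_freshHelpers (R := numRegular n d) hd (card_familyPlus hd hdn)
    (fun i => isSecond n d i) (fun x y hy => ?_) (fun i => groupIndex n d i)
    (fun x y hy => ((mem_familyPlus_iff hd hn x y).1 hy).1) (fun x => groupIndex_le _ _ _)
    (fun g => ?_) (fun g hg => ?_) ?_ ?_ l hl
  · have hN := two_mul_le_groupSize hd hn y.2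
    obtain ⟨h1, h2⟩ := (mem_familyPlus_iff hd hn x y).1 hy
    have h3 : groupStart n d x = groupStart n d y := by rw [groupStart_eq, groupStart_eq, h1]
    rw [h3] at h2
    cases hx : isSecond n d x
    · simpa [hx] using h2
    · simp only [hx, if_true] at h2
      simp only [Bool.not_true, isSecond, decide_eq_false_iff_not]
      omega
  · refine card_filter_fin_le _ (2 * d * g +
      (if g < numRegular n d then 2 * d else remainingSize n d) - d) d ?_
    rintro x ⟨rfl, hx⟩
    have hi := (groupIndex_eq_iff hd x.2 (groupIndex_le n d x)).1 rfl
    rw [← groupStart_eq, ← groupSize_eq] at hi ⊢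
    simp only [isSecond, decide_eq_true_eq] at hx
    have hN := two_mul_le_groupSize hd hn x.2
    omega
  · exact card_filter_fin_le _ (2 * d * g) (2 * d) fun x hx => (groupIndex_eq_of_lt hd hg).1 hx
  · by_cases hmod : n % (2 * d) = 0
    · exact Or.inl (remainingSize_eq_zero hmod)
    · exact Or.inr (two_mul_le_remainingSize hmod hn hd)
  · refine card_filter_fin_le _ (2 * d * numRegular n d) _ fun x hx => ?_
    have h1 := (groupIndex_eq_numRegular hd).1 hx
    have := remainingSize_add n d
    have := x.2
    omega

/-! ### An optimal sequence of repairs -/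

/-- The offset of the node that is repaired at position `s` in a group, the sides of which start at
the offsets `0` and `w`: the two sides take turns. -/
def turnOffset (w d s : ℕ) : ℕ :=
  if s < 2 * d then s / 2 + (if s % 2 = 1 then w else 0) else s - d

lemma turnOffset_lt {w d s : ℕ} (_hw : d ≤ w) (hs : s < w + d) : turnOffset w d s < w + d := by
  rw [turnOffset]
  split_ifs <;> omega

lemma turnOffset_injective {w d s s' : ℕ} (hw : d ≤ w) (hs : s < w + d) (hs' : s' < w + d)
    (h : turnOffset w d s = turnOffset w d s') : s = s' := by
  rw [turnOffset, turnOffset] at h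
  split_ifs at h <;> omega

/-- The node that is repaired at position `i`: the nodes of the remaining group come first, and then
those of the regular groups, one group after the other. -/
def planNode (n d i : ℕ) : ℕ :=
  if i < remainingSize n d then
    2 * d * numRegular n d + turnOffset (remainingSize n d - d) d i
  else 2 * d * ((i - remainingSize n d) / (2 * d)) +
    turnOffset d d ((i - remainingSize n d) % (2 * d))

lemma div_lt_numRegular {d i : ℕ} (hd : 1 ≤ d) (hi : i < n) (h : remainingSize n d ≤ i) :
    (i - remainingSize n d) / (2 * d) < numRegular n d := by
  have := remainingSize_add n d
  rw [Nat.div_lt_iff_lt_mul (by omega), mul_comm]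
  omega

lemma planNode_of_le {d q s : ℕ} (hs : s < 2 * d) :
    planNode n d (remainingSize n d + (2 * d * q + s)) = 2 * d * q + turnOffset d d s := by
  have h : (2 * d * q + s) / (2 * d) = q := by
    rw [Nat.mul_add_div (by omega), Nat.div_eq_of_lt hs, add_zero]
  rw [planNode, if_neg (by omega), Nat.add_sub_cancel_left, h, Nat.mul_add_mod,
    Nat.mod_eq_of_lt hs]

/-- A common form for regular and remaining groups: the plan enters group `g` at time `b`, and `s`
is the position within that group. -/
lemma exists_planNode {d : ℕ} (hd : 1 ≤ d) (hn : 2 * d ≤ n) {i : ℕ} (hi : i < n) :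
    ∃ g b s, i = b + s ∧ s < (if g < numRegular n d then 2 * d else remainingSize n d) ∧
      g ≤ numRegular n d ∧
      2 * d ≤ (if g < numRegular n d then 2 * d else remainingSize n d) ∧
      (∀ s' < (if g < numRegular n d then 2 * d else remainingSize n d),
        planNode n d (b + s') = 2 * d * g + turnOffset
          ((if g < numRegular n d then 2 * d else remainingSize n d) - d) d s') ∧
      d - (s + 1) / 2 = if i < remainingSize n d then d - (i + 1) / 2
        else d - ((i - remainingSize n d) % (2 * d) + 1) / 2 := by
  by_cases h : i < remainingSize n d
  · refine ⟨numRegular n d, 0, i, by simp, ?_⟩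
    simp only [lt_irrefl, if_false, h, if_true, le_refl, true_and, zero_add, and_true]
    refine ⟨?_, fun s' hs' => by rw [planNode, if_pos hs']⟩
    by_cases hmod : n % (2 * d) = 0
    · have := remainingSize_eq_zero hmod
      omega
    · exact two_mul_le_remainingSize hmod hn hd
  · have hq := div_lt_numRegular hd hi (not_lt.1 h)
    refine ⟨(i - remainingSize n d) / (2 * d),
      remainingSize n d + 2 * d * ((i - remainingSize n d) / (2 * d)),
      (i - remainingSize n d) % (2 * d), ?_, ?_⟩
    · rw [add_assoc, Nat.div_add_mod]
      omega
    · simp only [hq, if_true, h, if_false, le_refl, true_and, and_true]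
      refine ⟨Nat.mod_lt _ (by omega), hq.le, fun s' hs' => ?_⟩
      rw [add_assoc, planNode_of_le hs', show 2 * d - d = d by omega]

lemma planNode_lt {d : ℕ} (hd : 1 ≤ d) (hn : 2 * d ≤ n) {i : ℕ} (hi : i < n) :
    planNode n d i < n := by
  obtain ⟨g, b, s, rfl, hs, hg, hN, h, -⟩ := exists_planNode hd hn hi
  rw [h s hs]
  have h1 := turnOffset_lt (w := (if g < numRegular n d then 2 * d else remainingSize n d) - d)
    (d := d) (s := s) (by omega) (by omega)
  have h2 := remainingSize_add n d
  split_ifs at h1 ⊢ with hlt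
  · have : 2 * d * (g + 1) ≤ 2 * d * numRegular n d := Nat.mul_le_mul_left _ hlt
    rw [mul_add] at this
    omega
  · obtain rfl : g = numRegular n d := by omega
    simp only [lt_irrefl, if_false] at hs hN
    omega

lemma planNode_injective {d : ℕ} (hd : 1 ≤ d) (hn : 2 * d ≤ n) {i i' : ℕ} (hi : i < n)
    (hi' : i' < n) (h : planNode n d i = planNode n d i') : i = i' := by
  have hrem : ∀ {i}, i < remainingSize n d → 2 * d ≤ remainingSize n d := by
    intro i h
    by_cases hmod : n % (2 * d) = 0
    · have := remainingSize_eq_zero hmod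
      omega
    · exact two_mul_le_remainingSize hmod hn hd
  have hreg : ∀ {i}, i < n → ¬ i < remainingSize n d → 2 * d * ((i - remainingSize n d) / (2 * d)) +
      turnOffset d d ((i - remainingSize n d) % (2 * d)) < 2 * d * numRegular n d := by
    intro i hi h
    have h1 := div_lt_numRegular hd hi (not_lt.1 h)
    have h2 : 2 * d * ((i - remainingSize n d) / (2 * d) + 1) ≤ 2 * d * numRegular n d :=
      Nat.mul_le_mul_left _ h1
    have h3 := turnOffset_lt (w := d) (d := d) (s := (i - remainingSize n d) % (2 * d)) le_rfl
      (by rw [← two_mul]; exact Nat.mod_lt _ (by omega))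
    rw [mul_add] at h2
    omega
  rw [planNode, planNode] at h
  split_ifs at h with h1 h2 h2
  · have := hrem h1
    exact turnOffset_injective (d := d) (w := remainingSize n d - d) (by omega) (by omega)
      (by omega) (by omega)
  · have := hreg hi' h2
    omega
  · have := hreg hi h1
    omega
  · have hs : ∀ i, (i - remainingSize n d) % (2 * d) < d + d := fun i => by
      rw [← two_mul]
      exact Nat.mod_lt _ (by omega)
    have ho := fun i => turnOffset_lt (d := d) le_rfl (hs i)
    have hdiv : ∀ q o, o < d + d → (2 * d * q + o) / (2 * d) = q := fun q o ho => by
      rw [Nat.mul_add_div (by omega), Nat.div_eq_of_lt (by omega), add_zero]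
    have h3 := congrArg (· / (2 * d)) h
    simp only [hdiv _ _ (ho _)] at h3
    rw [h3, Nat.add_left_cancel_iff] at h
    have h4 := turnOffset_injective le_rfl (hs i) (hs i') h
    have h5 := Nat.div_add_mod (i - remainingSize n d) (2 * d)
    rw [h3, h4, Nat.div_add_mod] at h5
    omega

/-- At position `s < 2 * d` of a group the opposite side has had `(s + 1) / 2` turns, all spent on
actual helpers: the first side uses its first `d` nodes, the only ones that help the second. Later
positions belong to the first side, and all their helpers have been repaired. -/
lemma card_sdiff_plan_le {d : ℕ} (hd : 1 ≤ d) (hn : 2 * d ≤ n) (r : ℕ → Fin n)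
    (hr : ∀ i < n, (r i : ℕ) = planNode n d i) {i : ℕ} (hi : i < n) :
    (familyPlus n d (r i) \ (range i).image r).card ≤
      if i < remainingSize n d then d - (i + 1) / 2
        else d - ((i - remainingSize n d) % (2 * d) + 1) / 2 := by
  obtain ⟨g, b, s, rfl, hs, hg, hN, hplan, hval⟩ := exists_planNode hd hn hi
  rw [← hval]
  have hri := hr _ hi
  rw [hplan s hs] at hri
  have hlt := turnOffset_lt (w := (if g < numRegular n d then 2 * d else remainingSize n d) - d)
    (d := d) (s := s) (by omega) (by omega)
  have hgi : groupIndex n d (r (b + s)) = g :=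
    (groupIndex_eq_iff hd (r (b + s)).2 hg).2 (by omega)
  have hst : groupStart n d (r (b + s)) = 2 * d * g := by rw [groupStart_eq, hgi]
  have hsz := groupSize_eq n d (r (b + s))
  rw [hgi] at hsz
  set N := if g < numRegular n d then 2 * d else remainingSize n d with hNdef
  have hplan' : ∀ s' < s, r (b + s') ∈ (range (b + s)).image r ∧
      (r (b + s') : ℕ) = 2 * d * g + turnOffset (N - d) d s' := fun s' hs' =>
    ⟨mem_image_of_mem _ (mem_range.2 (by omega)), by
      rw [hr _ (by omega), hplan s' (by omega)]⟩
  have hmem : ∀ j ∈ familyPlus n d (r (b + s)), groupIndex n d j = g ∧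
      2 * d * g ≤ (j : ℕ) ∧ (j : ℕ) < 2 * d * g + N ∧
      if isSecond n d (r (b + s)) then (j : ℕ) < 2 * d * g + d else 2 * d * g + N ≤ j + d := by
    intro j hj
    obtain ⟨h1, h2⟩ := (mem_familyPlus_iff hd hn _ j).1 hj
    rw [hgi] at h1
    have h3 := (groupIndex_eq_iff hd j.2 hg).1 h1
    refine ⟨h1, h3.1, h3.2, ?_⟩
    rw [hst] at h2
    have h4 : isSecond n d j = true ↔ 2 * d * g + N ≤ j + d := by
      rw [isSecond, decide_eq_true_eq, groupStart_eq, groupSize_eq, h1]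
    rwa [h4] at h2
  -- The helpers fill a window of `d` nodes starting at offset `δ`; its first `(s + 1) / 2` nodes
  -- have been repaired.
  have hcount : ∀ δ : ℕ, (∀ j ∈ familyPlus n d (r (b + s)), 2 * d * g + δ ≤ (j : ℕ) ∧
      (j : ℕ) < 2 * d * g + δ + d) → (∀ m < (s + 1) / 2, m < d → ∃ s' < s,
        turnOffset (N - d) d s' = δ + m) →
      (familyPlus n d (r (b + s)) \ (range (b + s)).image r).card ≤ d - (s + 1) / 2 := by
    intro δ h1 h2
    rw [← Nat.card_Ico]
    refine card_le_card_of_injOn (fun j => (j : ℕ) - (2 * d * g + δ)) (fun j hj => ?_)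
      fun x hx y hy h => ?_
    · rw [mem_coe, mem_sdiff] at hj
      obtain ⟨h3, h4⟩ := h1 j hj.1
      simp only [coe_Ico, Set.mem_Ico]
      refine ⟨?_, by omega⟩
      by_contra hlt
      obtain ⟨s', hs', h5⟩ := h2 _ (not_le.1 hlt) (by omega)
      obtain ⟨h6, h7⟩ := hplan' s' hs'
      refine hj.2 ?_
      rwa [show j = r (b + s') from Fin.ext (by omega)]
    · rw [mem_coe, mem_sdiff] at hx hy
      have hx1 := h1 x hx.1
      have hy1 := h1 y hy.1
      simp only at h
      exact Fin.ext (by omega)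
  have hsec : isSecond n d (r (b + s)) = true ↔ N ≤ turnOffset (N - d) d s + d := by
    rw [isSecond, decide_eq_true_eq, hst, hsz, hri]
    omega
  by_cases hB : isSecond n d (r (b + s)) = true
  -- Even positions repair the first side and odd positions the second, so `2 * m` here and `2 * m +
  -- 1` below are the times of turn `m` of the helping side.
  · refine hcount 0 (fun j hj => ?_) fun m hm hmd => ⟨2 * m, ?_⟩
    · have := hmem j hj
      simp only [hB, if_true] at this
      omega
    · rw [hsec, turnOffset] at hB
      rw [turnOffset, if_pos (by omega)]
      split_ifs at hB ⊢ <;> omega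
  · refine hcount (N - d) (fun j hj => ?_) fun m hm hmd => ⟨2 * m + 1, ?_⟩
    · have := hmem j hj
      rw [if_neg hB] at this
      omega
    · rw [hsec, turnOffset] at hB
      rw [turnOffset, if_pos (by omega)]
      split_ifs at hB ⊢ <;> omega

lemma sum_card_eq_freshHelpers (D : Fin n → Finset (Fin n)) (r : ℕ → Fin n) (k : ℕ) :
    ∑ i ∈ range k, (D (r i) \ (range i).image r).card =
      freshHelpers D ((List.range k).map r).reverse := by
  induction k with
  | zero => simp [freshHelpers]
  | succ k ih =>
    rw [sum_range_succ, ih, List.range_succ, List.map_append, List.reverse_append]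
    have : ((List.range k).map r).reverse.toFinset = (range k).image r := by
      ext; simp
    simp [freshHelpers, this, add_comm]

lemma sum_plan_eq (n d k : ℕ) : ∑ i ∈ range k, (if i < remainingSize n d then d - (i + 1) / 2
    else d - ((i - remainingSize n d) % (2 * d) + 1) / 2) = planFresh n d k := by
  rw [planFresh, groupFresh, regularFresh]
  have hk : k = min k (remainingSize n d) + (k - remainingSize n d) := by omega
  conv_lhs => rw [hk, sum_range_add]
  congr 1
  · refine sum_congr rfl fun i hi => ?_
    rw [mem_range] at hi
    rw [if_pos (by omega)]
  · refine sum_congr rfl fun i hi => ?_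
    rw [mem_range] at hi
    rw [if_neg (by omega)]
    congr 5
    omega

lemma exists_freshHelpers_le_planFresh {d k : ℕ} (hd : 1 ≤ d) (hn : 2 * d ≤ n) (hk : k ≤ n) :
    ∃ l : List (Fin n), l.Nodup ∧ l.length = k ∧
      freshHelpers (familyPlus n d) l ≤ planFresh n d k := by
  let r : ℕ → Fin n := fun i =>
    if h : i < n then ⟨planNode n d i, planNode_lt hd hn h⟩ else ⟨0, by omega⟩
  have hr : ∀ i < n, (r i : ℕ) = planNode n d i := fun i hi => by simp [r, hi]
  refine ⟨((List.range k).map r).reverse, ?_, by simp, ?_⟩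
  · rw [List.nodup_reverse]
    refine List.Nodup.map_on (fun i hi i' hi' h => ?_) List.nodup_range
    rw [List.mem_range] at hi hi'
    refine planNode_injective hd hn (hi.trans_le hk) (hi'.trans_le hk) ?_
    rw [← hr i (by omega), ← hr i' (by omega), h]
  · rw [← sum_card_eq_freshHelpers, ← sum_plan_eq]
    exact sum_le_sum fun i hi => card_sdiff_plan_le hd hn r hr ((mem_range.1 hi).trans_le hk)

/-! ### The closed form over the reals. -/

lemma cast_groupFresh {d j : ℕ} (hj : j ≤ 2 * d) :
    (groupFresh d j : ℝ) = ∑ i ∈ range j, ((d : ℝ) - (i : ℝ) + ((i / 2 : ℕ) : ℝ)) := by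
  rw [groupFresh, Nat.cast_sum]
  refine sum_congr rfl fun i hi => ?_
  rw [mem_range] at hi
  -- The bound `j ≤ 2 * d` keeps the natural subtraction from truncating.
  rw [Nat.cast_sub (by omega)]
  have : (((i + 1) / 2 : ℕ) : ℝ) + ((i / 2 : ℕ) : ℝ) = i := by
    norm_cast
    omega
  linarith

lemma cast_planFresh {d : ℕ} (hd : 1 ≤ d) (hn : 2 * d ≤ n) (k : ℕ) :
    (planFresh n d k : ℝ) = (if n % (2 * d) ≠ 0 then
        ∑ i ∈ range (min k (2 * d - 1)), ((d : ℝ) - (i : ℝ) + ((i / 2 : ℕ) : ℝ)) else 0)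
      + (d : ℝ) ^ 2 * (((k - remainingSize n d) / (2 * d) : ℕ) : ℝ)
      + ∑ i ∈ range ((k - remainingSize n d) % (2 * d)),
          ((d : ℝ) - (i : ℝ) + ((i / 2 : ℕ) : ℝ)) := by
  rw [planFresh, regularFresh_eq hd, ← cast_groupFresh (Nat.mod_lt _ (by omega)).le,
    ← cast_groupFresh (show min k (2 * d - 1) ≤ 2 * d by omega)]
  -- The remaining group may be replaced by `2 * d - 1` nodes, since `groupFresh` is constant from
  -- there on.
  have h : groupFresh d (min k (remainingSize n d)) =
      if n % (2 * d) ≠ 0 then groupFresh d (min k (2 * d - 1)) else 0 := by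
    split_ifs with hmod
    · have := two_mul_le_remainingSize hmod hn hd
      rcases le_total k (2 * d - 1) with hk | hk
      · rw [min_eq_left hk, min_eq_left (by omega)]
      · rw [groupFresh_of_le (show 2 * d - 1 ≤ min k (remainingSize n d) by omega),
          groupFresh_of_le (show 2 * d - 1 ≤ min k (2 * d - 1) by omega)]
    · rw [remainingSize_eq_zero (not_not.1 hmod), Nat.min_zero, groupFresh_zero]
  rw [h]
  split_ifs <;> push_cast <;> ring

end HelperSelection

theorem mainTheorem10 (n k d : ℕ) (hn : 2 ≤ n) (hk : 1 ≤ k ∧ k ≤ n - 1)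
    (hd : 1 ≤ d ∧ d ≤ n - 1) (M : ℝ≥0) (hM : 0 < M) :
    ∃ α β : ℝ≥0,
      HelperSelection.IsMBRPoint (HelperSelection.familyPlus n d) k M α β ∧
      α = HelperSelection.repairBandwidth d β ∧
      HelperSelection.repairBandwidth d β = d * β ∧
      (2 * d ≤ n →
        ((if n % (2 * d) ≠ 0 then
            ∑ i ∈ Finset.range (min k (2 * d - 1)), ((d : ℝ) - (i : ℝ) + ((i / 2 : ℕ) : ℝ))
          else 0)
          + (d : ℝ) ^ 2 * (((k - HelperSelection.remainingSize n d) / (2 * d) : ℕ) : ℝ)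
          + ∑ i ∈ Finset.range ((k - HelperSelection.remainingSize n d) % (2 * d)),
              ((d : ℝ) - (i : ℝ) + ((i / 2 : ℕ) : ℝ))) * (β : ℝ) = (M : ℝ)) := by
  have hdn : d < n := by omega
  have hkn : k ≤ n := by omega
  have hD := HelperSelection.card_familyPlus hd.1 hdn
  obtain ⟨m, hm⟩ :=
    HelperSelection.exists_isLeast_freshHelpers (HelperSelection.familyPlus n d) hkn
  obtain ⟨hm0, hmbr⟩ := HelperSelection.isMBRPoint_of_isLeast hD hd.1 hk.1 hkn hm M
  refine ⟨_, _, hmbr, rfl, rfl, fun h2 => ?_⟩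
  rw [← HelperSelection.cast_planFresh hd.1 h2]
  have hmp : m = HelperSelection.planFresh n d k := by
    apply le_antisymm
    · obtain ⟨l, hl, hlk, hle⟩ := HelperSelection.exists_freshHelpers_le_planFresh hd.1 h2 hkn
      exact (hm.2 ⟨l, hl, hlk, rfl⟩).trans hle
    · obtain ⟨l, hl, rfl, rfl⟩ := hm.1
      exact HelperSelection.planFresh_le_freshHelpers hd.1 hdn h2 l hl
  rw [← hmp, NNReal.coe_div, NNReal.coe_natCast]
  exact mul_div_cancel₀ _ (by exact_mod_cast hm0.ne')
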